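/- Let $G$ be a locally compact (Hausdorff), second countable, unimodular group with Haar measure $dx$, and let $K$ be a compact subgroup of $G$ with normalized Haar measure $dk$. Let $\mu$ be the measure on $G/K$ determined by $\int_G f(x)\,dx=\int_{G/K}\int_K f(xk)\,dk\,d\mu(xK)$ for continuous compactly supported $f$. A compact set $E\subseteq G/K$ has the Pompeiu property if $f=0$ is the only continuous function $f\colon G/K\to\mathbb{C}$ with $\int_{gE} f\,d\mu=0$ for all $g\in G$. Let $\mathcal{C}(G)$ be the space of continuous complex-valued functions on $G$ with the topology of uniform convergence on compact sets, and $\mathcal{C}(G//K)$ its subspace of $K$-biinvariant functions, i.e. those with $f(kxl)=f(x)$ for all $k,l\in K$, $x\in G$. Let $\mathcal{M}_c(G//K)$ be the convolution algebra of compactly supported complex Borel measures $m$ on $G$ that are $K$-biinvariant, i.e. $\int_G f\,dm=\int_G\int_K\int_K f(lxk)\,dl\,dk\,dm(x)$ for all $f\in\mathcal{C}(G)$. The pair $(G,K)$ is a Gelfand pair if $\mathcal{M}_c(G//K)$ is commutative. A $K$-spherical function is a nonzero $f\in\mathcal{C}(G//K)$ with $\int_K f(xky)\,dk=f(x)f(y)$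 for all $x,y\in G$. A $K$-variety is a closed linear subspace $V$ of $\mathcal{C}(G//K)$ such that for all $f\in V$ and $g\in G$ the function $x\mapsto\int_K f(xkg)\,dk$ is in $V$. $K$-spectral analysis holds on $G$ if every nonzero $K$-variety contains a $K$-spherical function. For $E\subseteq G/K$ put $\widetilde{E}=\{g\in G: gK\in E\}$, let $\chi_{\widetilde E}$ be its characteristic function and $\check{\chi}_{\widetilde E}(x)=\chi_{\widetilde E}(x^{-1})$, and for $f\in\mathcal{C}(G)$ put $(f*\check{\chi}_{\widetilde E})(x)=\int_G f(xy^{-1})\,\check{\chi}_{\widetilde E}(y)\,dy$. Suppose that $(G,K)$ is a Gelfand pair and that $K$-spectral analysis holds on $G$. Let $E$ be a compact subset of $G/K$. Then $E$ has the Pompeiu property if and only if, for every $K$-spherical function $f$, the function $f*\check{\chi}_{\widetilde E}$ is not identically zero. -/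

import Mathlib

open MeasureTheory

open scoped Pointwise

namespace Pompeiu

noncomputable section

variable {G : Type*} [Group G] [TopologicalSpace G] [IsTopologicalGroup G]
  [MeasurableSpace G] [BorelSpace G]

/-! ### Haar measures -/

/-- The Haar measure of total mass `1` on the compact subgroup `K`. -/
def haarK (K : Subgroup G) [CompactSpace K] : Measure K :=
  Measure.haarMeasure ⊤

instance (K : Subgroup G) [CompactSpace K] : (haarK K).IsHaarMeasure :=
  inferInstanceAs (Measure.haarMeasure ⊤).IsHaarMeasure

instance (K : Subgroup G) [CompactSpace K] : IsProbabilityMeasure (haarK K) :=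
  ⟨Measure.haarMeasure_self⟩

/-- The measure on `G ⧸ K` induced by the measure `μ` on `G`: the image of `μ` under the projection
`G → G ⧸ K` (see `integral_quotientMeasure`). The quotient σ-algebra on `G ⧸ K` is its Borel
σ-algebra, see `borelSpace_quotient`. -/
def quotientMeasure (μ : Measure G) (K : Subgroup G) : Measure (G ⧸ K) :=
  μ.map fun g : G => (g : G ⧸ K)

theorem borelSpace_quotient [LocallyCompactSpace G] [T2Space G] [SecondCountableTopology G]
    (K : Subgroup G) [CompactSpace K] : BorelSpace (G ⧸ K) := by
  have hK : IsClosed (K : Set G) := (isCompact_iff_compactSpace.2 ‹_›).isClosed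
  let : UniformSpace G := IsTopologicalGroup.rightUniformSpace G
  have : IsRightUniformGroup G := { uniformity_eq := rfl }
  have : CompleteSpace G := IsRightUniformGroup.completeSpace_of_weaklyLocallyCompactSpace
  have : (uniformity G).IsCountablyGenerated := by
    rw [uniformity_eq_comap_mul_inv_nhds_one]
    infer_instance
  exact CosetSpace.borelSpace

/-- The formula that characterizes the measure on `G ⧸ K`: if `F (xK) = ∫ f (x k) dk`, then
`∫ f dx = ∫ F d(xK)`. -/
theorem integral_quotientMeasure [LocallyCompactSpace G] [T2Space G] [SecondCountableTopology G]
    (μ : Measure G) [μ.IsHaarMeasure] [μ.IsMulRightInvariant] (K : Subgroup G) [CompactSpace K]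
    (f : C(G, ℂ)) (hf : HasCompactSupport f) (F : G ⧸ K → ℂ)
    (hF : ∀ x : G, F x = ∫ k : K, f (x * k) ∂(haarK K)) :
    ∫ x, f x ∂μ = ∫ y, F y ∂(quotientMeasure μ K) := by
  have hcont : Continuous (Function.uncurry fun (x : G) (k : K) => f (x * k)) := by
    simp only [Function.uncurry_def]
    fun_prop
  have hFc : Continuous fun x : G => F x := by
    simp only [hF]
    simpa using continuous_parametric_integral_of_continuous (μ := haarK K) hcont isCompact_univ
  have hFm : Measurable F := measurable_from_quotient.2 hFc.measurable
  have hsupp : HasCompactSupport (Function.uncurry fun (x : G) (k : K) => f (x * k)) := by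
    have hc : IsCompact ((fun p : G × K => (p.1 * (p.2 : G)⁻¹, p.2)) ''
        (tsupport f ×ˢ Set.univ)) :=
      (IsCompact.prod hf isCompact_univ).image (by fun_prop)
    refine HasCompactSupport.intro hc fun p hp => ?_
    by_contra h
    exact hp ⟨(p.1 * p.2, p.2), ⟨subset_tsupport _ h, trivial⟩, by simp⟩
  rw [quotientMeasure, integral_map (by fun_prop) hFm.aestronglyMeasurable]
  simp only [hF]
  rw [integral_integral_swap_of_hasCompactSupport hcont hsupp]
  simp [integral_mul_right_eq_self (μ := μ) (fun x => f x)]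

/-! ### Convolution on `G` and the Pompeiu property -/

/-- The reflection `x ↦ φ x⁻¹` of a function `φ` on `G`. -/
def reflect (φ : G → ℂ) : G → ℂ := fun x => φ x⁻¹

/-- The lift to `G` of a subset `E` of `G ⧸ K`. -/
def lift (K : Subgroup G) (E : Set (G ⧸ K)) : Set G :=
  {g | (g : G ⧸ K) ∈ E}

/-- The characteristic function of a subset `A` of `G`. -/
def charFn (A : Set G) : G → ℂ := A.indicator fun _ => 1

/-- The convolution `(f * φ) x = ∫ f (x y⁻¹) φ y dy` with respect to the Haar measure `μ`. -/
def conv (μ : Measure G) (f φ : G → ℂ) : G → ℂ :=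
  fun x => ∫ y, f (x * y⁻¹) * φ y ∂μ

/-- `E ⊆ G ⧸ K` has the Pompeiu property: `f = 0` is the only continuous function on `G ⧸ K`
all of whose integrals over the translates `g E`, `g ∈ G`, vanish. -/
def HasPompeiuProperty (μ : Measure G) (K : Subgroup G) (E : Set (G ⧸ K)) : Prop :=
  ∀ f : C(G ⧸ K, ℂ), (∀ g : G, ∫ x in g • E, f x ∂(quotientMeasure μ K) = 0) → f = 0

/-! ### Biinvariant functions and measures, Gelfand pairs -/

/-- The space of continuous `K`-biinvariant functions on `G`. -/
def biinvariantFunctions (K : Subgroup G) : Submodule ℂ C(G, ℂ) where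
  carrier := {f | ∀ k ∈ K, ∀ l ∈ K, ∀ x, f (k * x * l) = f x}
  zero_mem' := fun _ _ _ _ _ => rfl
  add_mem' := fun {f g} hf hg k hk l hl x => by
    simp [hf k hk l hl x, hg k hk l hl x]
  smul_mem' := fun c f hf k hk l hl x => by
    simp [hf k hk l hl x]

/-- The projection `f♯ x = ∫∫ f (l x k) dl dk` of a function on `G` to a biinvariant one. -/
def sharp (K : Subgroup G) [CompactSpace K] (f : G → ℂ) : G → ℂ :=
  fun x => ∫ k : K, ∫ l : K, f (l * x * k) ∂(haarK K) ∂(haarK K)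

/-- The pairing `⟨f, m⟩ = ∫ f dm` of a function with a complex measure. -/
def pairing (f : G → ℂ) (m : ComplexMeasure G) : ℂ :=
  m.integral f (ContinuousLinearMap.mul ℝ ℂ)

/-- The complex Borel measure `m` has compact support. -/
def HasCompactSupportMeasure (m : ComplexMeasure G) : Prop :=
  ∃ C : Set G, IsCompact C ∧ ∀ A : Set G, MeasurableSet A → Disjoint A C → m A = 0

/-- Complex measures have finite variation, so that `pairing` and `measureConv` below are given by
genuine integrals and product measures. -/
instance isFiniteMeasure_variation {X : Type*} [MeasurableSpace X] (m : ComplexMeasure X) :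
    IsFiniteMeasure m.variation := by
  have h : m.variation ≤ (ComplexMeasure.re m).totalVariation +
      (ComplexMeasure.im m).totalVariation := by
    refine VectorMeasure.variation_le_of_forall_enorm_le fun s hs => ?_
    have h1 : m s = ((ComplexMeasure.re m s : ℝ) : ℂ) + (ComplexMeasure.im m s : ℝ) * Complex.I :=
      (Complex.re_add_im (m s)).symm
    calc ‖m s‖ₑ ≤ ‖((ComplexMeasure.re m s : ℝ) : ℂ)‖ₑ +
          ‖((ComplexMeasure.im m s : ℝ) : ℂ) * Complex.I‖ₑ := by
            rw [h1]; exact enorm_add_le _ _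
      _ = ‖ComplexMeasure.re m s‖ₑ + ‖ComplexMeasure.im m s‖ₑ := by
            simp [enorm_eq_nnnorm]
      _ ≤ _ := by
            rw [Measure.add_apply]
            exact add_le_add (SignedMeasure.enorm_le_totalVariation _ _)
              (SignedMeasure.enorm_le_totalVariation _ _)
  exact isFiniteMeasure_of_le _ h

/-- The set of compactly supported `K`-biinvariant complex Borel measures on `G`. -/
def biinvariantMeasures (K : Subgroup G) [CompactSpace K] : Set (ComplexMeasure G) :=
  {m | HasCompactSupportMeasure m ∧ ∀ f : C(G, ℂ), pairing f m = pairing (sharp K f) m}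

/-- The convolution of two complex measures: the image of the product measure under
multiplication. -/
def measureConv (m n : ComplexMeasure G) : ComplexMeasure G :=
  (m.prod n (ContinuousLinearMap.mul ℝ ℂ)).map fun p : G × G => p.1 * p.2

/-- `(G, K)` is a Gelfand pair: the convolution algebra of compactly supported `K`-biinvariant
measures is commutative. -/
def IsGelfandPair (K : Subgroup G) [CompactSpace K] : Prop :=
  ∀ m ∈ biinvariantMeasures K, ∀ n ∈ biinvariantMeasures K, measureConv m n = measureConv n m

/-! ### Spherical functions, varieties and spectral analysis -/

/-- `f` is a `K`-spherical function: a nonzero continuous `K`-biinvariant function with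
`∫ f (x k y) dk = f x * f y`. -/
def IsSpherical (K : Subgroup G) [CompactSpace K] (f : C(G, ℂ)) : Prop :=
  f ∈ biinvariantFunctions K ∧ f ≠ 0 ∧
    ∀ x y : G, ∫ k : K, f (x * k * y) ∂(haarK K) = f x * f y

/-- The (right) `K`-translation `x ↦ ∫ f (x k g) dk` of `f` by `g`. -/
def kTranslate [LocallyCompactSpace G] [SecondCountableTopology G]
    (K : Subgroup G) [CompactSpace K] (g : G) (f : C(G, ℂ)) : C(G, ℂ) where
  toFun x := ∫ k : K, f (x * k * g) ∂(haarK K)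
  continuous_toFun := by
    have h : Continuous (Function.uncurry fun (x : G) (k : K) => f (x * k * g)) := by
      simp only [Function.uncurry_def]
      fun_prop
    simpa using continuous_parametric_integral_of_continuous (μ := haarK K) h isCompact_univ

/-- A `K`-variety: a closed `K`-translation invariant linear subspace of the space of continuous
`K`-biinvariant functions, for the topology of uniform convergence on compact sets. -/
def IsKVariety [LocallyCompactSpace G] [SecondCountableTopology G]
    (K : Subgroup G) [CompactSpace K] (V : Submodule ℂ C(G, ℂ)) : Prop :=
  V ≤ biinvariantFunctions K ∧ IsClosed (V : Set C(G, ℂ)) ∧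
    ∀ f ∈ V, ∀ g : G, kTranslate K g f ∈ V

/-- `K`-spectral analysis holds on `V`: every nonzero `K`-variety contained in `V` contains a
`K`-spherical function. -/
def SpectralAnalysisHoldsOn [LocallyCompactSpace G] [SecondCountableTopology G]
    (K : Subgroup G) [CompactSpace K] (V : Submodule ℂ C(G, ℂ)) : Prop :=
  ∀ W : Submodule ℂ C(G, ℂ), IsKVariety K W → W ≤ V → W ≠ ⊥ → ∃ f ∈ W, IsSpherical K f

/-- `K`-spectral analysis holds on `G`. -/
def SpectralAnalysis [LocallyCompactSpace G] [SecondCountableTopology G]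
    (K : Subgroup G) [CompactSpace K] : Prop :=
  SpectralAnalysisHoldsOn K (biinvariantFunctions K)

end

end Pompeiu

/-! By `setIntegral_smul_quotientMeasure` and `conv_reflect_charFn`, integrals of a function on `G ⧸
K` over the translates of `E` are the values of the convolution of its lift with the reflected
characteristic function. A spherical function with zero convolution therefore descends to a
counterexample to the Pompeiu property.

Conversely, the biinvariant functions with vanishing integrals form a closed subspace
`vanishingSubmodule`. It is visibly stable under left translation followed by averaging over `K`.
The Gelfand condition, tested on uniform measures of double cosets, gives `∫ f (x k y) dk = ∫ f (y k
x) dk`, so the subspace is also stable under right `K`-translation and is a `K`-variety. A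
counterexample to the Pompeiu property, translated to be nonzero at `1` and averaged over `K` on the
left, shows that the variety is nonzero. Spectral analysis then puts a spherical function in it. -/

namespace Pompeiu

open scoped Topology

noncomputable section

/-! ### Finite measures as complex measures -/

section Complexification

variable {X Y : Type*} [MeasurableSpace X] [MeasurableSpace Y]

/-- A finite measure, as a complex measure. -/
def complexify (P : Measure X) [IsFiniteMeasure P] : ComplexMeasure X :=
  P.toSignedMeasure.toComplexMeasure 0

theorem complexify_apply (P : Measure X) [IsFiniteMeasure P] {s : Set X} (hs : MeasurableSet s) :
    complexify P s = P.real s := by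
  rw [complexify, SignedMeasure.toComplexMeasure_apply,
    Measure.toSignedMeasure_apply_measurable hs]
  rfl

theorem complexify_injective {P Q : Measure X} [IsFiniteMeasure P] [IsFiniteMeasure Q]
    (h : complexify P = complexify Q) : P = Q := by
  refine Measure.toSignedMeasure_eq_toSignedMeasure_iff.1 ?_
  simpa only [complexify, SignedMeasure.re_toComplexMeasure] using congrArg ComplexMeasure.re h

theorem variation_complexify (P : Measure X) [IsFiniteMeasure P] :
    (complexify P).variation = P := by
  apply le_antisymm
  · refine VectorMeasure.variation_le_of_forall_enorm_le fun s hs => ?_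
    rw [complexify_apply P hs, ← ofReal_norm, Complex.norm_real, Real.norm_eq_abs,
      abs_of_nonneg measureReal_nonneg, ofReal_measureReal]
  · refine Measure.le_iff.2 fun s hs => le_trans ?_ (VectorMeasure.enorm_measure_le_variation _ _)
    rw [complexify_apply P hs, ← ofReal_norm, Complex.norm_real, Real.norm_eq_abs,
      abs_of_nonneg measureReal_nonneg, ofReal_measureReal]

/-- Both integrals are `setToFun` extensions; by `variation_complexify` they are dominated by the
same measure, and they agree on indicators. -/
theorem integral_complexify (P : Measure X) [IsFiniteMeasure P] (f : X → ℂ) :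
    (complexify P).integral f (ContinuousLinearMap.mul ℝ ℂ) = ∫ x, f x ∂P := by
  rw [VectorMeasure.integral_eq_setToFun, MeasureTheory.integral_eq_setToFun]
  simp only [variation_complexify]
  refine setToFun_congr_left' _ _ (fun s hs _ => ?_) f
  ext
  simp [VectorMeasure.transpose, complexify_apply P hs, weightedSMul]

theorem pairing_complexify (P : Measure X) [IsFiniteMeasure P] (f : X → ℂ) :
    pairing f (complexify P) = ∫ x, f x ∂P :=
  integral_complexify P f

theorem complexify_map (P : Measure X) [IsFiniteMeasure P] {φ : X → Y} (hφ : Measurable φ) :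
    (complexify P).map φ = complexify (P.map φ) := by
  ext s hs
  rw [VectorMeasure.map_apply _ hφ hs, complexify_apply _ (hφ hs), complexify_apply _ hs,
    map_measureReal_apply hφ hs]

theorem complexify_prod (P : Measure X) (Q : Measure Y) [IsFiniteMeasure P] [IsFiniteMeasure Q] :
    (complexify P).prod (complexify Q) (ContinuousLinearMap.mul ℝ ℂ) = complexify (P.prod Q) := by
  refine VectorMeasure.prod_eq_of_forall_apply_prod fun s t hs ht => ?_
  rw [complexify_apply _ (hs.prod ht), complexify_apply _ hs, complexify_apply _ ht,
    measureReal_prod_prod]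
  simp

end Complexification

variable {G : Type*} [Group G] [TopologicalSpace G] [IsTopologicalGroup G]
  [MeasurableSpace G] [BorelSpace G]

theorem measureConv_complexify [SecondCountableTopology G] (P Q : Measure G) [IsFiniteMeasure P]
    [IsFiniteMeasure Q] :
    measureConv (complexify P) (complexify Q) =
      complexify ((P.prod Q).map fun p : G × G => p.1 * p.2) := by
  rw [measureConv, complexify_prod, complexify_map _ measurable_mul]

/-! ### Invariance properties of Haar measures -/

instance [T2Space G] (K : Subgroup G) [CompactSpace K] : (haarK K).IsMulRightInvariant where
  map_mul_right_eq_self g := by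
    have : IsProbabilityMeasure ((haarK K).map (· * g)) :=
      Measure.isProbabilityMeasure_map (by fun_prop)
    exact Measure.isHaarMeasure_eq_of_isProbabilityMeasure _ _

/-- Right invariance makes `μ.inv` left invariant, hence equal to `c • μ`; inverting twice forces `c
^ 2 = 1`. -/
theorem isInvInvariant_of_isMulRightInvariant [LocallyCompactSpace G] [T2Space G]
    [SecondCountableTopology G] (μ : Measure G) [μ.IsHaarMeasure] [μ.IsMulRightInvariant] :
    μ.IsInvInvariant := by
  constructor
  let c : ENNReal := Measure.haarScalarFactor μ.inv μ
  have hc : μ.inv = c • μ := Measure.isMulLeftInvariant_eq_smul μ.inv μ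
  have h : Measure.map Inv.inv (Measure.map Inv.inv μ) = c ^ 2 • μ := by
    rw [← Measure.inv_def μ, hc, Measure.map_smul, ← Measure.inv_def μ, hc, smul_smul, pow_two]
  have μeq : μ = c ^ 2 • μ := by
    rw [Measure.map_map continuous_inv.measurable continuous_inv.measurable] at h
    simpa only [inv_involutive, Function.Involutive.comp_self, Measure.map_id] using h
  have C : TopologicalSpace.PositiveCompacts G := Classical.arbitrary _
  have h2 : c ^ 2 * μ C = 1 ^ 2 * μ C := by
    conv_rhs => rw [μeq]
    simp
  have h3 : c ^ 2 = 1 ^ 2 :=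
    (ENNReal.mul_left_inj (Measure.measure_pos_of_nonempty_interior _ C.interior_nonempty).ne'
      C.isCompact.measure_lt_top.ne).1 h2
  rw [hc, (ENNReal.pow_right_strictMono two_ne_zero).injective h3, one_smul]

/-! ### Orbit measures -/

variable (K : Subgroup G)

instance [SecondCountableTopology G] : SecondCountableTopology K :=
  inferInstanceAs (SecondCountableTopology (K : Set G))

variable [CompactSpace K]

theorem sharp_mul_mul [T2Space G] (f : G → ℂ) (k l : K) (x : G) :
    sharp K f (k * x * l) = sharp K f x := by
  have h1 : ∀ a : K, ∫ b : K, f (b * (k * x * l) * a) ∂(haarK K) =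
      ∫ b : K, f (b * x * (l * a : K)) ∂(haarK K) := fun a => by
    rw [← integral_mul_right_eq_self (μ := haarK K) (fun b : K => f (b * x * (l * a : K))) k]
    simp [mul_assoc]
  simp only [sharp, h1]
  exact integral_mul_left_eq_self (μ := haarK K)
    (fun a : K => ∫ b : K, f (b * x * a) ∂(haarK K)) l

variable [SecondCountableTopology G]

/-- The image of the Haar measure of `K × K` on the double coset `K x K`. -/
def doubleCosetMeasure (x : G) : Measure G :=
  ((haarK K).prod (haarK K)).map fun p : K × K => (p.1 : G) * x * p.2

instance (x : G) : IsProbabilityMeasure (doubleCosetMeasure K x) :=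
  Measure.isProbabilityMeasure_map (by fun_prop)

theorem integral_doubleCosetMeasure (x : G) {f : G → ℂ} (hf : Continuous f) :
    ∫ y, f y ∂(doubleCosetMeasure K x) = ∫ p : K × K, f (p.1 * x * p.2)
      ∂((haarK K).prod (haarK K)) := by
  rw [doubleCosetMeasure, integral_map (by fun_prop) hf.aestronglyMeasurable]

theorem integrable_of_continuous_of_compactSpace {X : Type*} [TopologicalSpace X] [CompactSpace X]
    [MeasurableSpace X] [OpensMeasurableSpace X] (P : Measure X) [IsFiniteMeasure P]
    {f : X → ℂ} (hf : Continuous f) : Integrable f P :=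
  integrableOn_univ.1 (hf.continuousOn.integrableOn_compact' isCompact_univ MeasurableSet.univ)

theorem sharp_eq_integral_doubleCosetMeasure (x : G) {f : G → ℂ} (hf : Continuous f) :
    sharp K f x = ∫ y, f y ∂(doubleCosetMeasure K x) := by
  rw [integral_doubleCosetMeasure K x hf, integral_prod_symm _
    (integrable_of_continuous_of_compactSpace _ (by fun_prop))]
  rfl

theorem continuous_sharp {f : G → ℂ} (hf : Continuous f) [LocallyCompactSpace G] :
    Continuous (sharp K f) := by
  have h1 : Continuous (Function.uncurry fun (x : G) (p : K × K) => f (p.1 * x * p.2)) := by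
    simp only [Function.uncurry_def]
    fun_prop
  have h2 := continuous_parametric_integral_of_continuous
    (μ := (haarK K).prod (haarK K)) h1 isCompact_univ
  refine (by simpa using h2 : Continuous _).congr fun x => ?_
  rw [sharp_eq_integral_doubleCosetMeasure K x hf, integral_doubleCosetMeasure K x hf]

/-- These are the test measures for the Gelfand condition. Biinvariance holds because `sharp K f` is
constant on `K x K`, with value the mean of `f` there. -/
theorem complexify_doubleCosetMeasure_mem [LocallyCompactSpace G] [T2Space G] (x : G) :
    complexify (doubleCosetMeasure K x) ∈ biinvariantMeasures K := by
  refine ⟨⟨Set.range fun p : K × K => (p.1 : G) * x * p.2, isCompact_range (by fun_prop),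
    fun A hA hd => ?_⟩, fun f => ?_⟩
  · have h : (fun p : K × K => (p.1 : G) * x * p.2) ⁻¹' A = ∅ :=
      Set.eq_empty_of_forall_notMem fun p hp => hd.notMem_of_mem_left hp ⟨p, rfl⟩
    rw [complexify_apply _ hA, doubleCosetMeasure, map_measureReal_apply (by fun_prop) hA, h]
    simp
  · rw [pairing_complexify, pairing_complexify,
      integral_doubleCosetMeasure K x (continuous_sharp K f.continuous)]
    simp [sharp_mul_mul, sharp_eq_integral_doubleCosetMeasure K x f.continuous]

end

noncomputable section

variable {G : Type*} [Group G]

/-! ### Lifts of compact sets and biinvariant functions -/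

theorem lift_smul (K : Subgroup G) (E : Set (G ⧸ K)) (g : G) :
    lift K (g • E) = (g⁻¹ * ·) ⁻¹' lift K E := by
  ext x
  simp only [lift, Set.mem_ofPred_eq, Set.mem_preimage, Set.mem_smul_set_iff_inv_smul_mem]
  rfl

theorem isClosed_subgroup_of_compactSpace [TopologicalSpace G] [T2Space G] (K : Subgroup G)
    [CompactSpace K] : IsClosed (K : Set G) :=
  (isCompact_iff_compactSpace.2 ‹_›).isClosed

theorem isClosed_biinvariantFunctions [TopologicalSpace G] (K : Subgroup G) :
    IsClosed (biinvariantFunctions K : Set C(G, ℂ)) := by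
  have : (biinvariantFunctions K : Set C(G, ℂ)) =
      ⋂ k ∈ K, ⋂ l ∈ K, ⋂ x : G, {f : C(G, ℂ) | f (k * x * l) = f x} := by
    ext f
    simp only [Set.mem_iInter]
    rfl
  rw [this]
  refine isClosed_biInter fun k _ => isClosed_biInter fun l _ => isClosed_iInter fun x => ?_
  exact isClosed_eq (by fun_prop) (by fun_prop)

variable [TopologicalSpace G] [IsTopologicalGroup G]

theorem isClosed_lift [T2Space G] (K : Subgroup G) [CompactSpace K] {E : Set (G ⧸ K)}
    (hE : IsCompact E) : IsClosed (lift K E) := by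
  have : IsClosed (K : Set G) := isClosed_subgroup_of_compactSpace K
  exact hE.isClosed.preimage QuotientGroup.continuous_mk

/-- Finitely many images of compact neighbourhoods cover `E`, so the closed set `lift K E` lies in a
compact set times `K`. -/
theorem isCompact_lift [LocallyCompactSpace G] [T2Space G] (K : Subgroup G) [CompactSpace K]
    {E : Set (G ⧸ K)} (hE : IsCompact E) : IsCompact (lift K E) := by
  choose C hC hmem using fun x : G => exists_compact_mem_nhds x
  obtain ⟨t, ht⟩ := hE.elim_nhds_subcover' (fun y _ => (QuotientGroup.mk '' C y.out))
    (fun y _ => by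
      have h := (QuotientGroup.isOpenMap_coe (N := K)).image_mem_nhds (hmem y.out)
      rwa [QuotientGroup.out_eq'] at h)
  refine IsCompact.of_isClosed_subset
    (s := (⋃ y ∈ t, C (y : G ⧸ K).out) * (K : Set G)) ?_ (isClosed_lift K hE) fun g hg => ?_
  · exact (t.isCompact_biUnion fun y _ => hC _).mul (isCompact_iff_compactSpace.2 ‹_›)
  · obtain ⟨y, hy, c, hc, hcg⟩ := Set.mem_iUnion₂.1 (ht hg)
    exact ⟨c, Set.mem_biUnion hy hc, c⁻¹ * g, QuotientGroup.eq.1 hcg, by simp⟩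

variable [MeasurableSpace G] [BorelSpace G]

/-! ### Commutativity of translations for a Gelfand pair -/

/-- Biinvariance absorbs the two outer `K`-variables; the two inner ones enter only through their
product, which is again Haar distributed. -/
theorem integral_prod_doubleCosetMeasure [SecondCountableTopology G] (K : Subgroup G)
    [CompactSpace K] {f : C(G, ℂ)} (hf : f ∈ biinvariantFunctions K) (x y : G) :
    ∫ z, f z ∂(((doubleCosetMeasure K x).prod (doubleCosetMeasure K y)).map
      fun p : G × G => p.1 * p.2) = ∫ k : K, f (x * k * y) ∂(haarK K) := by
  have hinv : ∀ q : (K × K) × K × K,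
      f ((q.1.1 * x * q.1.2) * (q.2.1 * y * q.2.2)) = f (x * (q.1.2 * q.2.1 : K) * y) := fun q => by
    rw [← hf q.1.1 q.1.1.2 q.2.2 q.2.2.2 (x * (q.1.2 * q.2.1 : K) * y)]
    simp [mul_assoc]
  have hshift : ∀ k : K, ∫ l : K × K, f (x * (k * l.1 : K) * y) ∂((haarK K).prod (haarK K)) =
      ∫ k : K, f (x * k * y) ∂(haarK K) := fun k => by
    rw [integral_fun_fst (μ := haarK K) (ν := haarK K) (fun l : K => f (x * (k * l : K) * y)),
      integral_mul_left_eq_self (μ := haarK K) (fun l : K => f (x * l * y)) k]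
    simp
  rw [integral_map (by fun_prop) f.continuous.aestronglyMeasurable, doubleCosetMeasure,
    doubleCosetMeasure, Measure.map_prod_map _ _ (by fun_prop) (by fun_prop),
    integral_map (by fun_prop) (by fun_prop)]
  simp only [Prod.map_fst, Prod.map_snd, hinv]
  rw [integral_prod _ (integrable_of_continuous_of_compactSpace _ (by fun_prop))]
  simp only [hshift, integral_const, probReal_univ, one_smul]

theorem IsGelfandPair.integral_mul_mul_comm [LocallyCompactSpace G] [T2Space G]
    [SecondCountableTopology G] {K : Subgroup G} [CompactSpace K] (hG : IsGelfandPair K)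
    {f : C(G, ℂ)} (hf : f ∈ biinvariantFunctions K) (x y : G) :
    ∫ k : K, f (x * k * y) ∂(haarK K) = ∫ k : K, f (y * k * x) ∂(haarK K) := by
  have h := hG _ (complexify_doubleCosetMeasure_mem K x) _ (complexify_doubleCosetMeasure_mem K y)
  rw [measureConv_complexify, measureConv_complexify] at h
  rw [← integral_prod_doubleCosetMeasure K hf x y, complexify_injective h,
    integral_prod_doubleCosetMeasure K hf y x]

/-! ### Integrals over translates -/

theorem conv_reflect_charFn [LocallyCompactSpace G] [T2Space G] [SecondCountableTopology G]
    (μ : Measure G) [μ.IsHaarMeasure] [μ.IsMulRightInvariant] (f : G → ℂ) {A : Set G}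
    (hA : MeasurableSet A) (x : G) :
    conv μ f (reflect (charFn A)) x = ∫ y in A, f (x * y) ∂μ := by
  have : μ.IsInvInvariant := isInvInvariant_of_isMulRightInvariant μ
  rw [conv, ← integral_inv_eq_self, ← integral_indicator hA]
  congr 1 with y
  by_cases hy : y ∈ A <;> simp [reflect, charFn, hy]

theorem setIntegral_smul_quotientMeasure [LocallyCompactSpace G] [T2Space G]
    [SecondCountableTopology G] (μ : Measure G) [μ.IsHaarMeasure] (K : Subgroup G) [CompactSpace K]
    {E : Set (G ⧸ K)} (hE : IsCompact E) (f : C(G ⧸ K, ℂ)) (g : G) :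
    ∫ x in g • E, f x ∂(quotientMeasure μ K) = ∫ y in lift K E, f ((g * y : G) : G ⧸ K) ∂μ := by
  have := borelSpace_quotient K
  have hK : IsClosed (K : Set G) := isClosed_subgroup_of_compactSpace K
  have hgE : MeasurableSet (g • E) := (hE.smul g).isClosed.measurableSet
  have hpre : (fun x : G => (x : G ⧸ K)) ⁻¹' (g • E) = (g⁻¹ * ·) ⁻¹' lift K E := lift_smul K E g
  rw [quotientMeasure, setIntegral_map hgE f.continuous.aestronglyMeasurable (by fun_prop), hpre,
    ← integral_indicator ((isClosed_lift K hE).measurableSet.preimage (by fun_prop)),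
    ← integral_indicator (isClosed_lift K hE).measurableSet,
    ← integral_mul_left_eq_self (μ := μ) _ g]
  congr 1 with y
  by_cases hy : y ∈ lift K E <;> simp [hy]

theorem continuous_setIntegral_mul_left (μ : Measure G) [IsFiniteMeasureOnCompacts μ] [T2Space G]
    {A : Set G} (hA : IsCompact A) (x : G) :
    Continuous fun f : C(G, ℂ) => ∫ y in A, f (x * y) ∂μ := by
  have hint : ∀ f : C(G, ℂ), IntegrableOn (fun y => f (x * y)) A μ := fun f =>
    (by fun_prop : Continuous fun y => f (x * y)).continuousOn.integrableOn_compact hA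
  refine continuous_iff_continuousAt.2 fun f => Metric.tendsto_nhds.2 fun ε hε => ?_
  -- The `+ 1` keeps the denominator positive when `A` is a null set.
  have hc : 0 < μ.real A + 1 := by positivity
  have hu := Metric.tendstoUniformlyOn_iff.1
    (ContinuousMap.tendsto_iff_forall_isCompact_tendstoUniformlyOn.1
      (Filter.tendsto_id (x := 𝓝 f)) _ (hA.image (continuous_const_mul x)))
    (ε / (μ.real A + 1)) (by positivity)
  filter_upwards [hu] with h hh
  rw [dist_eq_norm, ← integral_sub (hint h) (hint f)]
  calc _ ≤ ε / (μ.real A + 1) * μ.real A :=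
        norm_setIntegral_le_of_norm_le_const hA.measure_lt_top fun y hy => by
          rw [← dist_eq_norm, dist_comm]
          exact (hh _ ⟨y, hy, rfl⟩).le
    _ < ε := by
        rw [div_mul_eq_mul_div, div_lt_iff₀ hc]
        nlinarith

/-! ### The variety of functions with vanishing integrals -/

/-- The continuous `K`-biinvariant functions whose integrals over all left translates of `A`
vanish. -/
def vanishingSubmodule (μ : Measure G) [IsFiniteMeasureOnCompacts μ] [T2Space G]
    (K : Subgroup G) {A : Set G} (hA : IsCompact A) : Submodule ℂ C(G, ℂ) where
  carrier := {f | f ∈ biinvariantFunctions K ∧ ∀ x, ∫ y in A, f (x * y) ∂μ = 0}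
  zero_mem' := ⟨zero_mem _, fun x => by simp⟩
  add_mem' := fun {f g} hf hg => ⟨add_mem hf.1 hg.1, fun x => by
    have hint : ∀ f : C(G, ℂ), IntegrableOn (fun y => f (x * y)) A μ := fun f =>
      (by fun_prop : Continuous fun y => f (x * y)).continuousOn.integrableOn_compact hA
    simp [integral_add (hint f) (hint g), hf.2 x, hg.2 x]⟩
  smul_mem' := fun c f hf => ⟨Submodule.smul_mem _ c hf.1, fun x => by
    simp [integral_const_mul, hf.2 x]⟩

theorem kTranslate_mem_biinvariantFunctions [LocallyCompactSpace G]
    [SecondCountableTopology G] {K : Subgroup G} [CompactSpace K]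
    {f : C(G, ℂ)} (hf : f ∈ biinvariantFunctions K) (g : G) :
    kTranslate K g f ∈ biinvariantFunctions K := by
  intro k hk l hl x
  change ∫ a : K, f (k * x * l * a * g) ∂(haarK K) = ∫ a : K, f (x * a * g) ∂(haarK K)
  rw [← integral_mul_left_eq_self (μ := haarK K) (fun a : K => f (x * a * g)) ⟨l, hl⟩]
  congr 1 with a
  rw [← hf k hk 1 (one_mem K) (x * (⟨l, hl⟩ * a : K) * g)]
  simp [mul_assoc]

theorem isKVariety_vanishingSubmodule [LocallyCompactSpace G] [T2Space G]
    [SecondCountableTopology G] (μ : Measure G) [μ.IsHaarMeasure] {K : Subgroup G} [CompactSpace K]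
    (hG : IsGelfandPair K) {A : Set G} (hA : IsCompact A) :
    IsKVariety K (vanishingSubmodule μ K hA) := by
  refine ⟨fun f hf => hf.1, ?_, fun f hf g => ⟨?_, fun x => ?_⟩⟩
  · have : (vanishingSubmodule μ K hA : Set C(G, ℂ)) =
        (biinvariantFunctions K : Set C(G, ℂ)) ∩
          ⋂ x : G, {f : C(G, ℂ) | ∫ y in A, f (x * y) ∂μ = 0} := by
      ext f
      simp only [Set.mem_inter_iff, Set.mem_iInter]
      rfl
    rw [this]
    exact (isClosed_biinvariantFunctions K).inter (isClosed_iInter fun x =>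
      isClosed_eq (continuous_setIntegral_mul_left μ hA x) continuous_const)
  · exact kTranslate_mem_biinvariantFunctions hf.1 g
  -- Commutativity moves `g` to the left of the argument; after Fubini, the inner integral vanishes
  -- by the hypothesis on `f` at `g * k * x`.
  · have h1 : ∀ y, kTranslate K g f (x * y) = ∫ k : K, f (g * k * x * y) ∂(haarK K) := fun y =>
      (hG.integral_mul_mul_comm hf.1 (x * y) g).trans (by simp only [mul_assoc])
    simp only [h1]
    have : IsFiniteMeasure (μ.restrict A) := ⟨by simpa using hA.measure_lt_top⟩
    rw [integral_integral_swap]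
    · simp [hf.2]
    · rw [← Measure.restrict_univ (μ := haarK K), Measure.prod_restrict]
      have hc : Continuous fun p : G × K => f (g * p.2 * x * p.1) := by fun_prop
      exact hc.continuousOn.integrableOn_compact (hA.prod isCompact_univ)

/-! ### Averaging over `K` -/

/-- The average `x ↦ ∫ f (k x) dk` of `f` over left translations by `K`. -/
def leftAverage [LocallyCompactSpace G] [SecondCountableTopology G]
    (K : Subgroup G) [CompactSpace K] (f : C(G, ℂ)) : C(G, ℂ) where
  toFun x := ∫ k : K, f (k * x) ∂(haarK K)
  continuous_toFun := by
    have h : Continuous (Function.uncurry fun (x : G) (k : K) => f (k * x)) := by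
      simp only [Function.uncurry_def]
      fun_prop
    simpa using continuous_parametric_integral_of_continuous (μ := haarK K) h isCompact_univ

theorem leftAverage_mem_vanishingSubmodule [LocallyCompactSpace G] [T2Space G]
    [SecondCountableTopology G] (μ : Measure G) [μ.IsHaarMeasure] {K : Subgroup G} [CompactSpace K]
    {A : Set G} (hA : IsCompact A) {f : C(G, ℂ)} (hf : ∀ x, ∀ k ∈ K, f (x * k) = f x)
    (hvan : ∀ x, ∫ y in A, f (x * y) ∂μ = 0) :
    leftAverage K f ∈ vanishingSubmodule μ K hA := by
  refine ⟨fun k hk l hl x => ?_, fun x => ?_⟩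
  · change ∫ a : K, f (a * (k * x * l)) ∂(haarK K) = ∫ a : K, f (a * x) ∂(haarK K)
    rw [← integral_mul_right_eq_self (μ := haarK K) (fun a : K => f (a * x)) ⟨k, hk⟩]
    congr 1 with a
    rw [← mul_assoc, hf _ l hl]
    simp [mul_assoc]
  · change ∫ y in A, ∫ k : K, f (k * (x * y)) ∂(haarK K) ∂μ = 0
    simp only [← mul_assoc]
    have : IsFiniteMeasure (μ.restrict A) := ⟨by simpa using hA.measure_lt_top⟩
    rw [integral_integral_swap]
    · simp [hvan]
    · rw [← Measure.restrict_univ (μ := haarK K), Measure.prod_restrict]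
      have hc : Continuous fun p : G × K => f (p.2 * x * p.1) := by fun_prop
      exact hc.continuousOn.integrableOn_compact (hA.prod isCompact_univ)

/-- Averaging could annihilate a function, but not one that is right `K`-invariant and nonzero at
`1`, since it is constant on `K`. -/
theorem leftAverage_one [LocallyCompactSpace G] [SecondCountableTopology G] {K : Subgroup G}
    [CompactSpace K] {f : C(G, ℂ)} (hf : ∀ x, ∀ k ∈ K, f (x * k) = f x) :
    leftAverage K f 1 = f 1 := by
  have h : ∀ k : K, f (k * 1) = f 1 := fun k => by simpa using hf 1 k k.2
  change ∫ k : K, f (k * 1) ∂(haarK K) = f 1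
  simp only [h, integral_const, probReal_univ, one_smul]

end

end Pompeiu

theorem mainTheorem3 {G : Type*} [Group G] [TopologicalSpace G] [IsTopologicalGroup G]
    [LocallyCompactSpace G] [T2Space G] [SecondCountableTopology G]
    [MeasurableSpace G] [BorelSpace G]
    (μ : Measure G) [μ.IsHaarMeasure] [μ.IsMulRightInvariant]
    (K : Subgroup G) [CompactSpace K]
    (hGelfand : Pompeiu.IsGelfandPair K) (hAnalysis : Pompeiu.SpectralAnalysis K)
    (E : Set (G ⧸ K)) (hE : IsCompact E) :
    Pompeiu.HasPompeiuProperty μ K E ↔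
      ∀ f : C(G, ℂ), Pompeiu.IsSpherical K f →
        Pompeiu.conv μ f (Pompeiu.reflect (Pompeiu.charFn (Pompeiu.lift K E))) ≠ 0 := by
  have hAm : MeasurableSet (Pompeiu.lift K E) := (Pompeiu.isClosed_lift K hE).measurableSet
  have hA := Pompeiu.isCompact_lift K hE
  constructor
  · rintro hP f ⟨hbi, hne, -⟩ h0
    let F : C(G ⧸ K, ℂ) := ⟨Quotient.lift f fun a b hab => by
      have h := hbi 1 (one_mem K) _ (QuotientGroup.leftRel_apply.1 hab) a
      simpa using h.symm, f.continuous.quotient_lift _⟩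
    have hF : F = 0 := hP F fun g => by
      rw [Pompeiu.setIntegral_smul_quotientMeasure μ K hE]
      exact (Pompeiu.conv_reflect_charFn μ f hAm g).symm.trans (congrFun h0 g)
    exact hne (ContinuousMap.ext fun x => DFunLike.congr_fun hF (x : G ⧸ K))
  · intro hS f hf
    by_contra hne
    obtain ⟨y, hy⟩ := DFunLike.ne_iff.1 hne
    obtain ⟨g, rfl⟩ := QuotientGroup.mk_surjective y
    -- Translating by `g` moves a point where `f` is nonzero to the identity, so that
    -- `leftAverage_one` applies.
    let F : C(G, ℂ) := ⟨fun x => f ((g * x : G) : G ⧸ K), by fun_prop⟩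
    have hFK : ∀ x, ∀ k ∈ K, F (x * k) = F x := fun x k hk => by
      change f _ = f _
      rw [← mul_assoc, QuotientGroup.mk_mul_of_mem _ hk]
    have hmem := Pompeiu.leftAverage_mem_vanishingSubmodule μ hA hFK fun x => by
      rw [← hf (g * x), Pompeiu.setIntegral_smul_quotientMeasure μ K hE]
      simp only [mul_assoc]
      rfl
    have hV := Pompeiu.isKVariety_vanishingSubmodule μ hGelfand hA
    obtain ⟨s, hs, hsph⟩ := hAnalysis _ hV hV.1 fun hbot => by
      rw [hbot, Submodule.mem_bot] at hmem
      have h1 := Pompeiu.leftAverage_one hFK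
      rw [hmem] at h1
      exact hy (by simpa [F] using h1.symm)
    exact hS s hsph (funext fun x => (Pompeiu.conv_reflect_charFn μ s hAm x).trans (hs.2 x))
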